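/- An $\mathbb{R}$-tree is a metric space $T$ such that (1) for all $a,b\in T$ there is a unique isometry $\phi_{ab}:[0,d(a,b)]\to T$ with $\phi_{ab}(0)=a$ and $\phi_{ab}(d(a,b))=b$, and (2) every injective continuous map $\varphi:[0,1]\to T$ has the same range as $\phi_{ab}$ with $a=\varphi(0)$, $b=\varphi(1)$. Write $[x,y]$ for the range of $\phi_{xy}$. A set $A\subseteq T$ is called measurable if $\phi_{xy}^{-1}(A)$ is Lebesgue measurable for all $x,y\in T$, and the length measure of such a set is $$\lambda_T(A)=\sup\sum_{k=1}^n\lambda\big(\phi_{x_ky_k}^{-1}(A)\big),$$ where $\lambda$ is Lebesgue measure on $\mathbb{R}$ and the supremum is over all finite families of pairwise disjoint segments $[x_1,y_1],\dots,[x_n,y_n]$ in $T$. For a metric space $M$ with a distinguished point $0$, let $\mathrm{Lip}_0(M)$ be the real Banach space of Lipschitz functions $f:M\to\mathbb{R}$ with $f(0)=0$, with the norm $$\|f\|=\sup\Big\{\frac{|f(q)-f(p)|}{d(p,q)}:\ p,q\in M,\ p\neq q\Big\}.$$ Let $\mathrm{SNA}(M)$ be the set of those $f\in\mathrm{Lip}_0(M)$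 for which this supremum is a maximum. Let $\mathcal{F}(M)$ be the closed linear span, in $\mathrm{Lip}_0(M)^*$, of the evaluations $\delta_x:f\mapsto f(x)$, $x\in M$. Each $f\in\mathrm{Lip}_0(M)$ defines the functional $T_f\in\mathcal{F}(M)^*$, $T_f(\mu)=\mu(f)$, and $f\mapsto T_f$ identifies $\mathrm{Lip}_0(M)$ isometrically with $\mathcal{F}(M)^*$. Under this identification, let $\mathrm{NA}(\mathcal{F}(M))\subseteq\mathrm{Lip}_0(M)$ be the set of those $f$ for which there is $\mu\in\mathcal{F}(M)$ with $\|\mu\|=1$ and $|T_f(\mu)|=\|T_f\|$. **Theorem.** Let $T$ be an $\mathbb{R}$-tree with a distinguished point $0$, and let $M\subseteq T$ be a closed subset that contains $0$ and has positive length measure, $\lambda_T(M)>0$. Then there is a linear isometry $J$ from $\ell_\infty$ into $\mathrm{Lip}_0(M)$ whose range is contained in $$\big(\mathrm{Lip}_0(M)\setminus\overline{\mathrm{SNA}(M)}\big)\cup\{0\}.$$ Moreover, there is a linear isometry from $c_0$ into $\mathrm{Lip}_0(M)$ whose range is contained in $$\big(\mathrm{NA}(\mathcal{F}(M))\setminus\overline{\mathrm{SNA}(M)}\big)\cup\{0\}.$$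 Here the closure is taken in the norm of $\mathrm{Lip}_0(M)$, and $\ell_\infty$, $c_0$ are the usual spaces of real sequences indexed by $\mathbb{N}$ with the supremum norm. -/

import Mathlib

open scoped ENNReal NNReal ZeroAtInfty

noncomputable section

/-! ### Real trees and the length measure -/

/-- `φ` is an isometry from the interval `[0, d(a, b)]` into `T` with `φ 0 = a` and
`φ (d(a, b)) = b`. -/
def IsGeodesic {T : Type*} [MetricSpace T] (a b : T)
    (φ : Set.Icc (0 : ℝ) (dist a b) → T) : Prop :=
  Isometry φ ∧ φ ⟨0, le_refl 0, dist_nonneg⟩ = a ∧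
    φ ⟨dist a b, dist_nonneg, le_refl (dist a b)⟩ = b

/-- `T` is an `ℝ`-tree. -/
structure IsRealTree (T : Type*) [MetricSpace T] : Prop where
  existsUnique_geodesic : ∀ a b : T, ∃! φ : Set.Icc (0 : ℝ) (dist a b) → T, IsGeodesic a b φ
  range_eq : ∀ γ : Set.Icc (0 : ℝ) 1 → T, Continuous γ → Function.Injective γ →
    ∀ φ : Set.Icc (0 : ℝ) (dist (γ 0) (γ 1)) → T, IsGeodesic (γ 0) (γ 1) φ →
      Set.range γ = Set.range φ

namespace IsRealTree

variable {T : Type*} [MetricSpace T]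

/-- The unique isometry `φ_{xy}` from `[0, d(x, y)]` to `T` joining `x` to `y`. -/
def geodesic (hT : IsRealTree T) (x y : T) : Set.Icc (0 : ℝ) (dist x y) → T :=
  (hT.existsUnique_geodesic x y).choose

/-- The segment `[x, y]`. -/
def segment (hT : IsRealTree T) (x y : T) : Set T :=
  Set.range (hT.geodesic x y)

/-- The Lebesgue measure of `φ_{xy}⁻¹(A)`, viewed as a subset of `ℝ`. -/
def segmentLength (hT : IsRealTree T) (x y : T) (A : Set T) : ℝ≥0∞ :=
  MeasureTheory.volume (Subtype.val '' (hT.geodesic x y ⁻¹' A) : Set ℝ)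

/-- The length measure of `A`: the supremum, over all finite families of pairwise disjoint
segments, of the total length of `A` in these segments. (It is used for sets `A` all of whose
preimages `φ_{xy}⁻¹(A)` are Lebesgue measurable, such as closed sets.) -/
def lengthMeasure (hT : IsRealTree T) (A : Set T) : ℝ≥0∞ :=
  ⨆ (F : Finset (T × T))
    (_ : (F : Set (T × T)).PairwiseDisjoint fun e => hT.segment e.1 e.2),
    ∑ e ∈ F, hT.segmentLength e.1 e.2 A

end IsRealTree

/-! ### The Banach space of Lipschitz functions vanishing at the distinguished point -/

section Lip

variable {M : Type*} [MetricSpace M]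

/-- The vector space of real Lipschitz functions on `M` that vanish at `o`. -/
def lipSubmodule (o : M) : Submodule ℝ (M → ℝ) where
  carrier := {f | (∃ K : ℝ≥0, LipschitzWith K f) ∧ f o = 0}
  add_mem' := by
    rintro f g ⟨⟨K, hf⟩, hf0⟩ ⟨⟨L, hg⟩, hg0⟩
    exact ⟨⟨K + L, hf.add hg⟩, by simp [hf0, hg0]⟩
  zero_mem' := ⟨⟨0, LipschitzWith.const 0⟩, rfl⟩
  smul_mem' := by
    rintro c f ⟨⟨K, hf⟩, hf0⟩
    refine ⟨⟨‖c‖₊ * K, ?_⟩, by simp [hf0]⟩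
    exact (lipschitzWith_smul c).comp hf

/-- `Lip₀(M)` for the pointed metric space `(M, o)`. It is a type synonym, so that it carries the
topology of the Lipschitz norm and not that of pointwise convergence. -/
def Lip0 (o : M) : Type _ := lipSubmodule o

namespace Lip0

variable {o : M}

instance : AddCommGroup (Lip0 o) := inferInstanceAs (AddCommGroup (lipSubmodule o))

instance : Module ℝ (Lip0 o) := inferInstanceAs (Module ℝ (lipSubmodule o))

instance : CoeFun (Lip0 o) (fun _ => M → ℝ) := ⟨fun f => f.1⟩

theorem coe_injective : Function.Injective (fun f : Lip0 o => (f : M → ℝ)) :=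
  Subtype.val_injective

theorem add_apply (f g : Lip0 o) (x : M) : (f + g) x = f x + g x := rfl

theorem smul_apply (c : ℝ) (f : Lip0 o) (x : M) : (c • f) x = c * f x := rfl

theorem apply_base (f : Lip0 o) : f o = 0 := f.2.2

/-- The incremental quotient `S(f, p, q) = (f(q) - f(p)) / d(p, q)`. -/
def slope (f : Lip0 o) (p q : M) : ℝ := (f q - f p) / dist p q

/-- The Lipschitz norm: the supremum of `|S(f, p, q)|` over all pairs of distinct points. -/
instance : Norm (Lip0 o) :=
  ⟨fun f => ⨆ e : {e : M × M // e.1 ≠ e.2}, |slope f e.1.1 e.1.2|⟩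

theorem norm_def (f : Lip0 o) :
    ‖f‖ = ⨆ e : {e : M × M // e.1 ≠ e.2}, |slope f e.1.1 e.1.2| := rfl

theorem bddAbove_slope (f : Lip0 o) :
    BddAbove (Set.range fun e : {e : M × M // e.1 ≠ e.2} => |slope f e.1.1 e.1.2|) := by
  obtain ⟨K, hK⟩ := f.2.1
  refine ⟨K, ?_⟩
  rintro _ ⟨⟨⟨p, q⟩, hpq⟩, rfl⟩
  have hd : 0 < dist p q := dist_pos.2 hpq
  have h := hK.dist_le_mul q p
  rw [Real.dist_eq, dist_comm q p] at h
  simp only [slope]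
  rw [abs_div, abs_of_pos hd, div_le_iff₀ hd]
  exact h

theorem abs_slope_le (f : Lip0 o) {p q : M} (h : p ≠ q) : |slope f p q| ≤ ‖f‖ :=
  le_ciSup (bddAbove_slope f) ⟨(p, q), h⟩

theorem norm_nonneg' (f : Lip0 o) : 0 ≤ ‖f‖ := Real.iSup_nonneg fun _ => abs_nonneg _

theorem abs_sub_le (f : Lip0 o) (p q : M) : |f q - f p| ≤ ‖f‖ * dist p q := by
  by_cases h : p = q
  · subst h; simp
  · have hd : 0 < dist p q := dist_pos.2 h
    have := abs_slope_le f h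
    rwa [slope, abs_div, abs_of_pos hd, div_le_iff₀ hd] at this

theorem normCore : NormedSpace.Core ℝ (Lip0 o) where
  norm_nonneg := norm_nonneg'
  norm_smul c f := by
    rw [norm_def, norm_def, Real.norm_eq_abs, Real.mul_iSup_of_nonneg (abs_nonneg c)]
    congr 1
    funext e
    rw [← abs_mul]
    simp only [slope, smul_apply]
    congr 1
    ring
  norm_triangle f g := by
    refine Real.iSup_le ?_ (add_nonneg (norm_nonneg' f) (norm_nonneg' g))
    rintro ⟨⟨p, q⟩, h⟩
    have e : slope (f + g) p q = slope f p q + slope g p q := by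
      simp only [slope, add_apply]; ring
    simp only [e]
    exact (abs_add_le _ _).trans (add_le_add (abs_slope_le f h) (abs_slope_le g h))
  norm_eq_zero_iff f := by
    constructor
    · intro h
      apply coe_injective
      funext x
      have := abs_sub_le f o x
      rw [h, zero_mul, apply_base, sub_zero] at this
      exact abs_eq_zero.1 (le_antisymm this (abs_nonneg _))
    · rintro rfl
      refine le_antisymm (Real.iSup_le (fun e => ?_) le_rfl) (norm_nonneg' _)
      have : slope (0 : Lip0 o) e.1.1 e.1.2 = 0 := by
        change ((0 : ℝ) - 0) / _ = 0
        simp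
      simp [this]

instance : NormedAddCommGroup (Lip0 o) := NormedAddCommGroup.ofCore normCore

instance : NormedSpace ℝ (Lip0 o) := NormedSpace.ofCore normCore

/-- The evaluation functional `δ_x` on `Lip₀(M)`. -/
def eval (o x : M) : StrongDual ℝ (Lip0 o) :=
  LinearMap.mkContinuous
    { toFun := fun f : Lip0 o => f x
      map_add' := fun _ _ => rfl
      map_smul' := fun _ _ => rfl } (dist o x) (fun f => by
        have h := abs_sub_le f o x
        rw [apply_base, sub_zero, mul_comm] at h
        exact h)

/-- The strongly norm-attaining functions: the supremum that defines the norm is a maximum. -/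
def SNA (o : M) : Set (Lip0 o) :=
  {f | ∃ p q : M, p ≠ q ∧ |slope f p q| = ‖f‖}

end Lip0

/-! ### The Lipschitz-free space and norm-attaining functionals -/

/-- The norm-closed linear span of the evaluation functionals in the dual of `Lip₀(M)`. -/
def lipschitzFreeSubmodule (o : M) : Submodule ℝ (StrongDual ℝ (Lip0 o)) :=
  (Submodule.span ℝ (Set.range (Lip0.eval o))).topologicalClosure

/-- The Lipschitz-free space `F(M)`, with the norm of the dual of `Lip₀(M)`. -/
def LipschitzFree (o : M) : Type _ := lipschitzFreeSubmodule o

namespace LipschitzFree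

variable {o : M}

instance : NormedAddCommGroup (LipschitzFree o) :=
  inferInstanceAs (NormedAddCommGroup (lipschitzFreeSubmodule o))

instance : NormedSpace ℝ (LipschitzFree o) :=
  inferInstanceAs (NormedSpace ℝ (lipschitzFreeSubmodule o))

/-- The inclusion of `F(M)` in the dual of `Lip₀(M)`. -/
def incl (μ : LipschitzFree o) : StrongDual ℝ (Lip0 o) := μ.1

/-- The element `δ_x` of `F(M)`. -/
def delta (o x : M) : LipschitzFree o :=
  ⟨Lip0.eval o x, Submodule.le_topologicalClosure _ (Submodule.subset_span ⟨x, rfl⟩)⟩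

theorem norm_incl (μ : LipschitzFree o) : ‖μ.incl‖ = ‖μ‖ := rfl

end LipschitzFree

/-- The functional `T_f` on `F(M)` that corresponds to `f ∈ Lip₀(M)`, `T_f μ = μ f`. It is the
unique bounded linear functional with `T_f δ_x = f x` for all `x`. -/
def Lip0.toDual {o : M} (f : Lip0 o) : StrongDual ℝ (LipschitzFree o) :=
  LinearMap.mkContinuous
    { toFun := fun μ : LipschitzFree o => μ.incl f
      map_add' := fun _ _ => rfl
      map_smul' := fun _ _ => rfl } ‖f‖ (fun μ => by
        rw [mul_comm, ← LipschitzFree.norm_incl]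
        exact μ.incl.le_opNorm f)

theorem Lip0.toDual_delta {o : M} (f : Lip0 o) (x : M) :
    f.toDual (LipschitzFree.delta o x) = f x := rfl

/-- The bounded linear functionals on `X` that attain their norm on the unit sphere. -/
def normAttaining (X : Type*) [NormedAddCommGroup X] [NormedSpace ℝ X] :
    Set (StrongDual ℝ X) :=
  {φ | ∃ x : X, ‖x‖ = 1 ∧ |φ x| = ‖φ‖}

/-- `NA(F(M))` as a subset of `Lip₀(M) = F(M)*`. -/
def Lip0.NA (o : M) : Set (Lip0 o) :=
  {f | f.toDual ∈ normAttaining (LipschitzFree o)}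

end Lip

/-- The subset `A` of `X` contains a linearly isometric copy of `E`. -/
def IsometricallyContains (E : Type*) [NormedAddCommGroup E] [NormedSpace ℝ E]
    {X : Type*} [NormedAddCommGroup X] [NormedSpace ℝ X] (A : Set X) : Prop :=
  ∃ J : E →ₗᵢ[ℝ] X, ∀ x : E, J x ∈ A

end

/-!
Choose a segment `[x, y]` of the tree whose trace on `M` has positive length, and let `C ⊆ ℝ` be the
compact set of parameters of that trace. Every point `p` of the tree has a nearest point on the
segment, its gate, and the geodesic between two points with different gates runs through both gates
(`IsRealTree.dist_eq_of_gate_ne`): the two legs and the part of the segment between the gates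
concatenate to an arc, which in a real tree is a geodesic. The parameter `π p` of the gate is thus a
1-Lipschitz map, and all points of the copy of `C` with parameters between `π p` and `π q` lie
metrically between `p` and `q`. This is all that is used of the tree (`IsGatedCopy`).

Inside `C` there is a compact set `A` of positive measure that is so thin that every interval in
which `A` has positive measure contains two points `u < v` of `C` with no point of `A` between them
(`IsCompact.exists_thin_subset`). Split `A` into countably many measurable pieces `A n` of positive
measure. A bounded sequence `x` is mapped to the function `f p = ∫ w` over `[π o, π p]`, where `w`
equals `x n` on `A n` and vanishes off `A`. Clearly `‖f‖ ≤ ‖x‖`.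

For the reverse inequality and for norm attainment, averaging the derivative along a compact
subset `K` of `A n` is a functional of norm at most one that belongs to the Lipschitz-free space
(`LipschitzFree.exists_average`), since it is a norm limit of normalised sums of increments over
finite families of intervals with endpoints in `K`. It takes the value `x n` at `f`. So `‖f‖ = ‖x‖`,
and `f` attains its norm on the free space when `|x n| = ‖x‖` for some `n`, as happens for every
null sequence.

Finally, let `g` attain its Lipschitz norm at the pair `p, q`. Then `g` has extremal slope between
any two points that lie in order between `p` and `q`. But `f` is constant on `{p, q}`, or on the
pair of points with parameters `u < v` as above, so `g` cannot be close to a nonzero `f`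
(`IsGatedCopy.notMem_closure_SNA`).
-/

open MeasureTheory Set Filter Topology

/-! ### Segments and gates in real trees -/

namespace IsRealTree

variable {T : Type*} [MetricSpace T] (hT : IsRealTree T)

/-- The geodesic from `x` to `y`, extended to `ℝ` so that it is constant on both sides of
`[0, d(x, y)]`. -/
noncomputable def path (x y : T) (t : ℝ) : T :=
  hT.geodesic x y (projIcc 0 (dist x y) dist_nonneg t)

theorem isGeodesic_geodesic (x y : T) : IsGeodesic x y (hT.geodesic x y) :=
  (hT.existsUnique_geodesic x y).choose_spec.1

theorem path_of_mem {x y : T} {t : ℝ} (ht : t ∈ Icc 0 (dist x y)) :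
    hT.path x y t = hT.geodesic x y ⟨t, ht⟩ := by
  rw [path, projIcc_of_mem _ ht]

theorem continuous_path (x y : T) : Continuous (hT.path x y) :=
  (hT.isGeodesic_geodesic x y).1.continuous.comp continuous_projIcc

theorem path_zero (x y : T) : hT.path x y 0 = x := by
  rw [hT.path_of_mem ⟨le_rfl, dist_nonneg⟩]
  exact (hT.isGeodesic_geodesic x y).2.1

theorem path_dist (x y : T) : hT.path x y (dist x y) = y := by
  rw [hT.path_of_mem ⟨dist_nonneg, le_rfl⟩]
  exact (hT.isGeodesic_geodesic x y).2.2

theorem dist_path {x y : T} {s t : ℝ} (hs : s ∈ Icc 0 (dist x y)) (ht : t ∈ Icc 0 (dist x y)) :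
    dist (hT.path x y s) (hT.path x y t) = |s - t| := by
  rw [hT.path_of_mem hs, hT.path_of_mem ht, (hT.isGeodesic_geodesic x y).1.dist_eq]
  rfl

theorem injOn_path (x y : T) : InjOn (hT.path x y) (Icc 0 (dist x y)) := by
  intro s hs t ht h
  have := hT.dist_path hs ht
  rw [h, dist_self] at this
  exact sub_eq_zero.1 (abs_eq_zero.1 this.symm)

theorem segment_eq_image_path (x y : T) : hT.segment x y = hT.path x y '' Icc 0 (dist x y) := by
  ext z
  constructor
  · rintro ⟨t, rfl⟩
    exact ⟨t, t.2, hT.path_of_mem t.2⟩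
  · rintro ⟨t, ht, rfl⟩
    exact ⟨⟨t, ht⟩, (hT.path_of_mem ht).symm⟩

theorem path_mem_segment {x y : T} {t : ℝ} (ht : t ∈ Icc 0 (dist x y)) :
    hT.path x y t ∈ hT.segment x y := by
  rw [segment_eq_image_path]
  exact mem_image_of_mem _ ht

theorem left_mem_segment (x y : T) : x ∈ hT.segment x y := by
  simpa [path_zero] using hT.path_mem_segment (x := x) (y := y) ⟨le_rfl, dist_nonneg⟩

theorem dist_add_dist_of_mem_segment {x y z : T} (hz : z ∈ hT.segment x y) :
    dist x z + dist z y = dist x y := by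
  rw [segment_eq_image_path] at hz
  obtain ⟨t, ht, rfl⟩ := hz
  have h1 := hT.dist_path (x := x) (y := y) ⟨le_rfl, dist_nonneg⟩ ht
  have h2 := hT.dist_path (x := x) (y := y) ht ⟨dist_nonneg, le_rfl⟩
  rw [path_zero] at h1
  rw [path_dist] at h2
  rw [h1, h2, abs_of_nonpos (by linarith [ht.1]), abs_of_nonpos (by linarith [ht.2])]
  ring

/-- Every arc, parametrised by any nondegenerate compact interval, traces out the segment between
its endpoints. -/
theorem image_eq_segment {γ : ℝ → T} {a b : ℝ} (hab : a < b) (hc : ContinuousOn γ (Icc a b))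
    (hi : InjOn γ (Icc a b)) : γ '' Icc a b = hT.segment (γ a) (γ b) := by
  have hmaps : ∀ u : Icc (0 : ℝ) 1, a + u * (b - a) ∈ Icc a b := by
    rintro ⟨u, h0, h1⟩
    constructor
    · have := mul_nonneg h0 (sub_pos.2 hab).le
      simp only
      linarith
    · have := mul_le_mul_of_nonneg_right h1 (sub_pos.2 hab).le
      simp only
      linarith
  let δ : Icc (0 : ℝ) 1 → T := fun u => γ (a + u * (b - a))
  have hδc : Continuous δ := hc.comp_continuous (by fun_prop) hmaps
  have hδi : Function.Injective δ := by
    intro u v h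
    have h' := hi (hmaps u) (hmaps v) h
    have : (u : ℝ) * (b - a) = v * (b - a) := by linarith
    exact Subtype.ext (mul_right_cancel₀ (sub_pos.2 hab).ne' this)
  have key : ∀ x y, δ 0 = x → δ 1 = y → range δ = hT.segment x y := by
    rintro x y rfl rfl
    exact hT.range_eq δ hδc hδi _ (hT.isGeodesic_geodesic _ _)
  rw [← key (γ a) (γ b) (by simp [δ]) (by simp [δ])]
  ext z
  constructor
  · rintro ⟨t, ht, rfl⟩
    have hba : 0 < b - a := sub_pos.2 hab
    refine ⟨⟨(t - a) / (b - a), div_nonneg (by linarith [ht.1]) hba.le,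
      (div_le_one hba).2 (by linarith [ht.2])⟩, ?_⟩
    change γ (a + (t - a) / (b - a) * (b - a)) = γ t
    rw [div_mul_cancel₀ _ hba.ne']
    congr 1
    ring
  · rintro ⟨u, rfl⟩
    exact ⟨_, hmaps u, rfl⟩

theorem segment_self (x : T) : hT.segment x x = {x} := by
  ext z
  constructor
  · intro hz
    have := hT.dist_add_dist_of_mem_segment hz
    rw [dist_self] at this
    rw [dist_comm x z] at this
    exact dist_eq_zero.1 (by linarith : dist z x = 0)
  · rintro rfl
    exact hT.left_mem_segment _ _

theorem segment_comm (x y : T) : hT.segment x y = hT.segment y x := by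
  rcases eq_or_ne x y with rfl | hxy
  · rfl
  have hd : 0 < dist x y := dist_pos.2 hxy
  have hmaps : MapsTo (fun u => dist x y - u) (Icc 0 (dist x y)) (Icc 0 (dist x y)) :=
    fun u hu => ⟨by linarith [hu.2], by linarith [hu.1]⟩
  have := hT.image_eq_segment (γ := fun u => hT.path x y (dist x y - u)) hd
    ((hT.continuous_path x y).comp (by fun_prop)).continuousOn
    ((hT.injOn_path x y).comp (sub_right_injective.injOn) hmaps)
  simp only [sub_zero, sub_self, path_zero, path_dist] at this
  rw [← this, segment_eq_image_path]
  ext z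
  constructor
  · rintro ⟨t, ht, rfl⟩
    exact ⟨dist x y - t, hmaps ht, by simp⟩
  · rintro ⟨t, ht, rfl⟩
    exact ⟨_, hmaps ht, rfl⟩

/-- A subsegment of a segment is again traced out by the geodesic. -/
theorem segment_path_subset {x y : T} {s t : ℝ} (hs : s ∈ Icc 0 (dist x y))
    (ht : t ∈ Icc 0 (dist x y)) :
    hT.segment (hT.path x y s) (hT.path x y t) ⊆ hT.segment x y := by
  wlog hst : s ≤ t generalizing s t
  · rw [segment_comm]
    exact this ht hs (le_of_not_ge hst)
  rcases hst.eq_or_lt with rfl | hst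
  · rw [segment_self, singleton_subset_iff]
    exact hT.path_mem_segment hs
  have hsub : Icc s t ⊆ Icc 0 (dist x y) := Icc_subset_Icc hs.1 ht.2
  rw [← hT.image_eq_segment hst (hT.continuous_path x y).continuousOn
    ((hT.injOn_path x y).mono hsub), segment_eq_image_path]
  exact image_mono hsub

/-- Two segments that meet only in a common endpoint concatenate to a segment. -/
theorem mem_segment_of_inter {a b c : T}
    (h : ∀ z ∈ hT.segment a b, z ∈ hT.segment b c → z = b) :
    b ∈ hT.segment a c ∧ hT.segment a c ⊆ hT.segment a b ∪ hT.segment b c := by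
  set l := dist a b with hl
  set m := dist b c with hm
  have hl0 : 0 ≤ l := dist_nonneg
  have hm0 : 0 ≤ m := dist_nonneg
  rcases (add_nonneg hl0 hm0).eq_or_lt with h0 | hpos
  · have hab : a = b := dist_eq_zero.1 (by linarith)
    subst hab
    exact ⟨hT.left_mem_segment _ _, subset_union_right⟩
  let γ : ℝ → T := fun u => if u ≤ l then hT.path a b u else hT.path b c (u - l)
  have hγc : Continuous γ := by
    refine Continuous.if_le (hT.continuous_path a b) ((hT.continuous_path b c).comp (by fun_prop))
      continuous_id continuous_const ?_
    rintro u rfl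
    simp [hl, path_dist, path_zero]
  have h1 : ∀ u ∈ Icc 0 (l + m), u ≤ l → γ u = hT.path a b u ∧ u ∈ Icc 0 (dist a b) :=
    fun u hu hul => ⟨if_pos hul, hu.1, hul⟩
  have h2 : ∀ u ∈ Icc 0 (l + m), ¬ u ≤ l →
      γ u = hT.path b c (u - l) ∧ u - l ∈ Icc 0 (dist b c) :=
    fun u hu hul => ⟨if_neg hul, by linarith, by linarith [hu.2]⟩
  have cross : ∀ u ∈ Icc 0 (l + m), ∀ v ∈ Icc 0 (l + m), u ≤ l → ¬ v ≤ l → γ u ≠ γ v := by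
    intro u hu v hv hul hvl huv
    obtain ⟨eu, mu⟩ := h1 u hu hul
    obtain ⟨ev, mv⟩ := h2 v hv hvl
    have hz : hT.path b c (v - l) = b := by
      refine h _ ?_ (hT.path_mem_segment mv)
      rw [← ev, ← huv, eu]
      exact hT.path_mem_segment mu
    have := hT.injOn_path b c mv ⟨le_rfl, dist_nonneg⟩ (hz.trans (hT.path_zero b c).symm)
    exact hvl (by linarith)
  have hγi : InjOn γ (Icc 0 (l + m)) := by
    intro u hu v hv huv
    by_cases hul : u ≤ l <;> by_cases hvl : v ≤ l
    · rw [(h1 u hu hul).1, (h1 v hv hvl).1] at huv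
      exact hT.injOn_path a b (h1 u hu hul).2 (h1 v hv hvl).2 huv
    · exact absurd huv (cross u hu v hv hul hvl)
    · exact absurd huv.symm (cross v hv u hu hvl hul)
    · rw [(h2 u hu hul).1, (h2 v hv hvl).1] at huv
      have := hT.injOn_path b c (h2 u hu hul).2 (h2 v hv hvl).2 huv
      linarith
  have e0 : γ 0 = a := by simp [γ, hl0, path_zero]
  have e1 : γ (l + m) = c := by
    by_cases hm' : l + m ≤ l
    · have hbc : b = c := dist_eq_zero.1 (by linarith)
      have hlm : l + m = dist a b := by linarith
      rw [(h1 _ ⟨hpos.le, le_rfl⟩ hm').1, hlm, path_dist, hbc]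
    · rw [(h2 _ ⟨hpos.le, le_rfl⟩ hm').1, add_sub_cancel_left, path_dist]
  have himg := hT.image_eq_segment hpos hγc.continuousOn hγi
  rw [e0, e1] at himg
  rw [← himg]
  constructor
  · refine ⟨l, ⟨hl0, by linarith⟩, ?_⟩
    simp [γ, hl, path_dist]
  · rintro _ ⟨u, hu, rfl⟩
    by_cases hul : u ≤ l
    · left
      rw [(h1 u hu hul).1]
      exact hT.path_mem_segment (h1 u hu hul).2
    · right
      rw [(h2 u hu hul).1]
      exact hT.path_mem_segment (h2 u hu hul).2

/-- A nearest point of a segment is a gate: every geodesic from `p` to the segment enters the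
segment there. -/
theorem exists_gate (x y p : T) : ∃ t ∈ Icc 0 (dist x y), ∀ s ∈ Icc 0 (dist x y),
    dist p (hT.path x y s) = dist p (hT.path x y t) + |s - t| := by
  have hcont : Continuous fun u => dist p (hT.path x y u) :=
    continuous_const.dist (hT.continuous_path x y)
  obtain ⟨t, ht, hmin⟩ := isCompact_Icc.exists_isMinOn
    (nonempty_Icc.2 (dist_nonneg (x := x) (y := y))) hcont.continuousOn
  refine ⟨t, ht, fun s hs => ?_⟩
  have hmem : hT.path x y t ∈ hT.segment p (hT.path x y s) := by
    refine (hT.mem_segment_of_inter ?_).1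
    intro z hz hz'
    have hz'' := hT.segment_path_subset ht hs hz'
    rw [segment_eq_image_path] at hz''
    obtain ⟨u, hu, rfl⟩ := hz''
    have h1 := hT.dist_add_dist_of_mem_segment hz
    have h2 : dist p (hT.path x y t) ≤ dist p (hT.path x y u) := hmin hu
    exact dist_eq_zero.1 (le_antisymm (by linarith) dist_nonneg)
  rw [← hT.dist_add_dist_of_mem_segment hmem, hT.dist_path ht hs, abs_sub_comm]

/-- The parameter of the point of `[x, y]` nearest to `p`. -/
noncomputable def gate (x y p : T) : ℝ := (hT.exists_gate x y p).choose

theorem gate_mem (x y p : T) : hT.gate x y p ∈ Icc 0 (dist x y) :=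
  (hT.exists_gate x y p).choose_spec.1

theorem dist_path_eq_gate (x y p : T) {s : ℝ} (hs : s ∈ Icc 0 (dist x y)) :
    dist p (hT.path x y s) = dist p (hT.path x y (hT.gate x y p)) + |s - hT.gate x y p| :=
  (hT.exists_gate x y p).choose_spec.2 s hs

theorem gate_path {x y : T} {s : ℝ} (hs : s ∈ Icc 0 (dist x y)) :
    hT.gate x y (hT.path x y s) = s := by
  have h := hT.dist_path_eq_gate x y (hT.path x y s) hs
  rw [dist_self] at h
  have hn := dist_nonneg (x := hT.path x y s) (y := hT.path x y (hT.gate x y (hT.path x y s)))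
  have h1 : |s - hT.gate x y (hT.path x y s)| = 0 := le_antisymm (by linarith) (abs_nonneg _)
  linarith [abs_eq_zero.1 h1]

theorem gate_of_mem_segment {x y p z : T}
    (hz : z ∈ hT.segment p (hT.path x y (hT.gate x y p))) : hT.gate x y z = hT.gate x y p := by
  have h1 := hT.dist_add_dist_of_mem_segment hz
  have h2 := hT.dist_path_eq_gate x y p (hT.gate_mem x y z)
  have h3 := hT.dist_path_eq_gate x y z (hT.gate_mem x y p)
  have h4 := dist_triangle p z (hT.path x y (hT.gate x y z))
  have h5 := abs_nonneg (hT.gate x y z - hT.gate x y p)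
  rw [abs_sub_comm] at h3
  have h6 : |hT.gate x y z - hT.gate x y p| = 0 := by linarith
  linarith [abs_eq_zero.1 h6]

/-- Points with different gates are joined through both gates. -/
theorem dist_eq_of_gate_ne {x y p q : T} (h : hT.gate x y p ≠ hT.gate x y q) :
    dist p q = dist p (hT.path x y (hT.gate x y p)) + |hT.gate x y q - hT.gate x y p| +
      dist (hT.path x y (hT.gate x y q)) q := by
  set s := hT.gate x y p with hs
  set t := hT.gate x y q with ht
  have hsm : s ∈ Icc 0 (dist x y) := hT.gate_mem x y p
  have htm : t ∈ Icc 0 (dist x y) := hT.gate_mem x y q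
  -- a point of the segment that lies on the way from a point to its gate is that gate
  have honly : ∀ {r z : T}, z ∈ hT.segment r (hT.path x y (hT.gate x y r)) →
      z ∈ hT.segment x y → z = hT.path x y (hT.gate x y r) := by
    intro r z hz hz'
    rw [segment_eq_image_path] at hz'
    obtain ⟨u, hu, rfl⟩ := hz'
    rw [← hT.gate_of_mem_segment hz, hT.gate_path hu]
  have step1 := hT.mem_segment_of_inter (a := p) (b := hT.path x y s) (c := hT.path x y t)
    fun z hz hz' => honly hz (hT.segment_path_subset hsm htm hz')
  have step2 := hT.mem_segment_of_inter (a := p) (b := hT.path x y t) (c := q) (by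
    intro z hz hz'
    rw [segment_comm] at hz'
    rcases step1.2 hz with hz1 | hz1
    · exact absurd ((hT.gate_of_mem_segment hz1).symm.trans (hT.gate_of_mem_segment hz')) h
    · exact honly hz' (hT.segment_path_subset hsm htm hz1))
  rw [← hT.dist_add_dist_of_mem_segment step2.1, ← hT.dist_add_dist_of_mem_segment step1.1,
    hT.dist_path hsm htm, abs_sub_comm]

theorem abs_gate_sub_le (x y p q : T) : |hT.gate x y q - hT.gate x y p| ≤ dist p q := by
  by_cases h : hT.gate x y p = hT.gate x y q
  · simp [h]
  · rw [hT.dist_eq_of_gate_ne h]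
    linarith [dist_nonneg (x := p) (y := hT.path x y (hT.gate x y p)),
      dist_nonneg (x := hT.path x y (hT.gate x y q)) (y := q)]

/-- Points of `[x, y]` between two gates are met, in order, on the way from `p` to `q`. -/
theorem dist_eq_of_gate_le {x y p q : T} {s t : ℝ} (hps : hT.gate x y p ≤ s) (hst : s < t)
    (htq : t ≤ hT.gate x y q) :
    dist p q = dist p (hT.path x y s) + (t - s) + dist (hT.path x y t) q := by
  have hs : s ∈ Icc 0 (dist x y) :=
    ⟨(hT.gate_mem x y p).1.trans hps, by linarith [(hT.gate_mem x y q).2]⟩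
  have ht : t ∈ Icc 0 (dist x y) :=
    ⟨by linarith [(hT.gate_mem x y p).1], htq.trans (hT.gate_mem x y q).2⟩
  rw [hT.dist_eq_of_gate_ne (x := x) (y := y) (by linarith : hT.gate x y p < hT.gate x y q).ne,
    hT.dist_path_eq_gate x y p hs, dist_comm (hT.path x y t) q, hT.dist_path_eq_gate x y q ht,
    abs_of_nonneg (by linarith), abs_of_nonneg (by linarith), abs_of_nonpos (by linarith),
    dist_comm (hT.path x y (hT.gate x y q)) q]
  ring

end IsRealTree

/-! ### Compact subsets of the line with positive measure -/

/-- A compact subset of the line is covered, up to small measure, by finitely many disjoint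
intervals with endpoints in the set: inside an open neighbourhood of small excess measure, take the
convex hulls of its parts in the connected components of the neighbourhood. -/
theorem IsCompact.exists_finset_Icc_cover {K : Set ℝ} (hK : IsCompact K) {ε : ℝ} (hε : 0 < ε) :
    ∃ (S : Finset (Set ℝ)) (a b : Set ℝ → ℝ),
      (∀ U ∈ S, a U ∈ K ∧ b U ∈ K ∧ a U ≤ b U) ∧
      (S : Set (Set ℝ)).PairwiseDisjoint (fun U => Icc (a U) (b U)) ∧
      K ⊆ ⋃ U ∈ S, Icc (a U) (b U) ∧
      volume.real ((⋃ U ∈ S, Icc (a U) (b U)) \ K) ≤ ε := by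
  classical
  obtain ⟨V, hKV, hVo, -, hV⟩ := hK.measurableSet.exists_isOpen_sdiff_lt
    (μ := volume) hK.measure_ne_top (ENNReal.ofReal_pos.2 hε).ne'
  obtain ⟨t, htK, htcov⟩ := hK.elim_nhds_subcover (fun x => connectedComponentIn V x)
    fun x hx => hVo.connectedComponentIn.mem_nhds (mem_connectedComponentIn (hKV hx))
  set S : Finset (Set ℝ) := t.image fun x => connectedComponentIn V x with hS
  have hSmem : ∀ U ∈ S, ∃ x ∈ K, U = connectedComponentIn V x := by
    intro U hU
    obtain ⟨x, hx, rfl⟩ := Finset.mem_image.1 hU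
    exact ⟨x, htK x hx, rfl⟩
  have hSo : ∀ U ∈ S, IsOpen U := by
    intro U hU
    obtain ⟨x, -, rfl⟩ := hSmem U hU
    exact hVo.connectedComponentIn
  have hSd : ∀ U ∈ S, ∀ W ∈ S, U ≠ W → Disjoint U W := by
    intro U hU W hW hUW
    obtain ⟨x, -, rfl⟩ := hSmem U hU
    obtain ⟨y, -, rfl⟩ := hSmem W hW
    rw [Set.disjoint_iff_forall_ne]
    rintro z hzx _ hzy rfl
    exact hUW ((connectedComponentIn_eq hzx).trans (connectedComponentIn_eq hzy).symm)
  have hScov : ∀ x ∈ K, ∃ U ∈ S, x ∈ U := by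
    intro x hx
    obtain ⟨y, hy, hxy⟩ := mem_iUnion₂.1 (htcov hx)
    exact ⟨_, Finset.mem_image_of_mem _ hy, hxy⟩
  have hcomp : ∀ U ∈ S, IsCompact (K ∩ U) := by
    intro U hU
    have : K ∩ U = K \ ⋃ W ∈ S.erase U, W := by
      ext x
      simp only [mem_inter_iff, Set.mem_sdiff, mem_iUnion, not_exists, and_congr_right_iff]
      intro hx
      constructor
      · intro hxU W hW hxW
        rw [Finset.mem_erase] at hW
        exact Set.disjoint_left.1 (hSd W hW.2 U hU hW.1) hxW hxU
      · intro h
        obtain ⟨W, hW, hxW⟩ := hScov x hx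
        by_cases hWU : W = U
        · exact hWU ▸ hxW
        · exact absurd hxW (h W (Finset.mem_erase.2 ⟨hWU, hW⟩))
    rw [this]
    exact hK.diff (isOpen_biUnion fun W hW => hSo W (Finset.mem_of_mem_erase hW))
  have hne : ∀ U ∈ S, (K ∩ U).Nonempty := by
    intro U hU
    obtain ⟨x, hx, rfl⟩ := hSmem U hU
    exact ⟨x, hx, mem_connectedComponentIn (hKV hx)⟩
  have ha : ∀ U ∈ S, sInf (K ∩ U) ∈ K ∩ U := fun U hU => (hcomp U hU).sInf_mem (hne U hU)
  have hb : ∀ U ∈ S, sSup (K ∩ U) ∈ K ∩ U := fun U hU => (hcomp U hU).sSup_mem (hne U hU)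
  have hsubU : ∀ U ∈ S, Icc (sInf (K ∩ U)) (sSup (K ∩ U)) ⊆ U := by
    intro U hU
    have hoc : U.OrdConnected := by
      obtain ⟨x, -, rfl⟩ := hSmem U hU
      exact isPreconnected_connectedComponentIn.ordConnected
    exact hoc.out (ha U hU).2 (hb U hU).2
  have hsubV : ∀ U ∈ S, U ⊆ V := by
    intro U hU
    obtain ⟨x, -, rfl⟩ := hSmem U hU
    exact connectedComponentIn_subset V x
  refine ⟨S, fun U => sInf (K ∩ U), fun U => sSup (K ∩ U), ?_, ?_, ?_, ?_⟩
  · exact fun U hU => ⟨(ha U hU).1, (hb U hU).1,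
      csInf_le (hcomp U hU).bddBelow (hb U hU)⟩
  · intro U hU W hW hUW
    exact (hSd U hU W hW hUW).mono (hsubU U hU) (hsubU W hW)
  · intro x hx
    obtain ⟨U, hU, hxU⟩ := hScov x hx
    exact mem_iUnion₂.2 ⟨U, hU, csInf_le (hcomp U hU).bddBelow ⟨hx, hxU⟩,
      le_csSup (hcomp U hU).bddAbove ⟨hx, hxU⟩⟩
  · refine ENNReal.toReal_le_of_le_ofReal hε.le (le_trans (measure_mono ?_) hV.le)
    exact sdiff_subset_sdiff_left (iUnion₂_subset fun U hU => (hsubU U hU).trans (hsubV U hU))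

/-- A set of positive measure contains two points at arbitrarily small distance. -/
theorem exists_lt_sub_le_of_volume_ne_zero {E : Set ℝ} (hE : volume E ≠ 0) {ε : ℝ} (hε : 0 < ε) :
    ∃ u ∈ E, ∃ v ∈ E, u < v ∧ v - u ≤ ε := by
  by_contra! hcon
  refine hE ?_
  have hcov : E = ⋃ k : ℤ, E ∩ {t | ⌊t / ε⌋ = k} := by
    ext t
    simp
  rw [hcov, measure_iUnion_null_iff]
  intro k
  refine Set.Subsingleton.measure_zero ?_ _
  have key : ∀ u v : ℝ, u ∈ E → v ∈ E → ⌊u / ε⌋ = k → ⌊v / ε⌋ = k → ¬ u < v := by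
    intro u v hu hv huk hvk huv
    have h1 := Int.abs_sub_lt_one_of_floor_eq_floor (hvk.trans huk.symm)
    rw [← sub_div, abs_div, abs_of_pos hε, div_lt_one hε, abs_of_pos (sub_pos.2 huv)] at h1
    exact absurd (hcon u hu v hv huv) (not_lt.2 h1.le)
  rintro u ⟨hu, huk⟩ v ⟨hv, hvk⟩
  exact le_antisymm (not_lt.1 (key v u hv hu hvk huk)) (not_lt.1 (key u v hu hv huk hvk))

/-- A compact set `C` of positive measure has a compact subset `A` of positive measure that is
nowhere dense relative to `C`, in the sense that each interval in which `A` has positive measure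
contains two points of `C` with no point of `A` between them. From each of countably many
intervals a short gap with endpoints in `C` is removed. -/
theorem IsCompact.exists_thin_subset {C : Set ℝ} (hC : IsCompact C) (hpos : 0 < volume C) :
    ∃ A ⊆ C, IsCompact A ∧ 0 < volume A ∧ ∀ p q, volume (A ∩ Icc p q) = 0 ∨
      ∃ u ∈ C, ∃ v ∈ C, p ≤ u ∧ u < v ∧ v ≤ q ∧ A ∩ Ioo u v = ∅ := by
  let ι := {e : ℚ × ℚ // volume (C ∩ Ioo (e.1 : ℝ) e.2) ≠ 0}
  obtain ⟨ε, hε, hsum⟩ := ENNReal.exists_pos_sum_of_countable hpos.ne' ι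
  have hex : ∀ i : ι, ∃ u v : ℝ, u ∈ C ∩ Ioo (i.1.1 : ℝ) i.1.2 ∧ v ∈ C ∩ Ioo (i.1.1 : ℝ) i.1.2 ∧
      u < v ∧ v - u ≤ ε i := by
    intro i
    obtain ⟨u, hu, v, hv, huv⟩ := exists_lt_sub_le_of_volume_ne_zero i.2 (NNReal.coe_pos.2 (hε i))
    exact ⟨u, v, hu, hv, huv⟩
  choose u v hu hv huv hle using hex
  refine ⟨C \ ⋃ i, Ioo (u i) (v i), sdiff_subset, hC.diff (isOpen_iUnion fun i => isOpen_Ioo),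
    ?_, ?_⟩
  · rw [pos_iff_ne_zero]
    intro h0
    have h1 : volume (⋃ i, Ioo (u i) (v i)) < volume C := by
      refine (measure_iUnion_le _).trans_lt (lt_of_le_of_lt (ENNReal.tsum_le_tsum fun i => ?_) hsum)
      rw [Real.volume_Ioo, ENNReal.ofReal_le_iff_le_toReal ENNReal.coe_ne_top]
      exact hle i
    have h2 := measure_le_inter_add_sdiff volume C (⋃ i, Ioo (u i) (v i))
    rw [h0, add_zero] at h2
    exact absurd (h2.trans (measure_mono inter_subset_right)) (not_le.2 h1)
  · intro p q
    refine or_iff_not_imp_left.2 fun hne => ?_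
    have hCne : volume (C ∩ Ioo p q) ≠ 0 := by
      intro h0
      refine hne (measure_mono_null (inter_subset_inter_left _ sdiff_subset) ?_)
      rw [← h0]
      exact measure_congr ((ae_eq_refl C).inter Ioo_ae_eq_Icc.symm)
    have hex : ∃ e : ℚ × ℚ, p < e.1 ∧ (e.2 : ℝ) < q ∧ volume (C ∩ Ioo (e.1 : ℝ) e.2) ≠ 0 := by
      by_contra! hcon
      refine hCne (measure_mono_null ?_ (measure_iUnion_null (s := fun e : ℚ × ℚ =>
        {x | x ∈ C ∩ Ioo (e.1 : ℝ) e.2 ∧ p < e.1 ∧ (e.2 : ℝ) < q}) fun e => ?_))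
      · rintro x ⟨hxC, hpx, hxq⟩
        obtain ⟨r, hr, hr'⟩ := exists_rat_btwn hpx
        obtain ⟨s, hs, hs'⟩ := exists_rat_btwn hxq
        exact mem_iUnion.2 ⟨(r, s), ⟨hxC, hr', hs⟩, hr, hs'⟩
      · by_cases h : p < e.1 ∧ (e.2 : ℝ) < q
        · exact measure_mono_null (fun x hx => hx.1) (hcon e h.1 h.2)
        · have : {x | x ∈ C ∩ Ioo (e.1 : ℝ) e.2 ∧ p < e.1 ∧ (e.2 : ℝ) < q} = ∅ :=
            eq_empty_of_forall_notMem fun x hx => h hx.2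
          rw [this, measure_empty]
    obtain ⟨e, hpe, heq, he⟩ := hex
    let i : ι := ⟨e, he⟩
    refine ⟨u i, (hu i).1, v i, (hv i).1, (hpe.trans (hu i).2.1).le, huv i,
      ((hv i).2.2.trans heq).le, ?_⟩
    refine eq_empty_of_forall_notMem fun x hx => hx.1.2 (mem_iUnion.2 ⟨i, hx.2⟩)

/-- A bounded measurable set of positive measure can be split measurably into countably many pieces
of positive measure. With `m t` the measure of the part of `A` below `t` and `a` that of `A`, the
piece of `t` is the integer part of `m t / (a - m t)`, which grows from `0` to `∞`. -/
theorem IsCompact.exists_measurable_nat_fibers {A : Set ℝ} (hA : IsCompact A)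
    (hpos : 0 < volume A) :
    ∃ N : ℝ → ℕ, Measurable N ∧ ∀ n, 0 < volume (A ∩ N ⁻¹' {n}) := by
  have hfin : ∀ B : Set ℝ, volume (A ∩ B) ≠ ∞ := fun B =>
    measure_ne_top_of_subset inter_subset_left hA.measure_ne_top
  set m : ℝ → ℝ := fun t => volume.real (A ∩ Iic t) with hm
  have hadd : ∀ s t, s ≤ t → m t = m s + volume.real (A ∩ Ioc s t) := by
    intro s t hst
    have : A ∩ Iic t = (A ∩ Iic s) ∪ (A ∩ Ioc s t) := by
      rw [← inter_union_distrib_left, Iic_union_Ioc_eq_Iic hst]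
    rw [hm]
    simp only
    rw [this, measureReal_union _ (hA.measurableSet.inter measurableSet_Ioc) (hfin _) (hfin _)]
    exact (Iic_disjoint_Ioc le_rfl).mono inter_subset_right inter_subset_right
  have hmono : Monotone m := fun s t hst => by
    rw [hadd s t hst]
    exact le_add_of_nonneg_right measureReal_nonneg
  have hlip : LipschitzWith 1 m := by
    refine LipschitzWith.of_le_add fun s t => ?_
    rcases le_total s t with hst | hst
    · exact (hmono hst).trans (le_add_of_nonneg_right dist_nonneg)
    · rw [hadd t s hst, Real.dist_eq, abs_of_nonneg (sub_nonneg.2 hst)]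
      gcongr
      calc volume.real (A ∩ Ioc t s) ≤ volume.real (Ioc t s) :=
            measureReal_mono inter_subset_right measure_Ioc_lt_top.ne
        _ = s - t := by rw [Real.volume_real_Ioc_of_le hst]
  set a : ℝ := volume.real A with ha
  have ha0 : 0 < a := ENNReal.toReal_pos hpos.ne' hA.measure_ne_top
  obtain ⟨l, hl⟩ := hA.bddBelow
  obtain ⟨r, hr⟩ := hA.bddAbove
  have hml : m (l - 1) = 0 := by
    have : A ∩ Iic (l - 1) = ∅ :=
      eq_empty_of_forall_notMem fun x hx => by
        have := hl hx.1
        have : x ≤ l - 1 := hx.2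
        linarith
    simp [hm, this]
  have hmr : m r = a := by
    have : A ∩ Iic r = A := inter_eq_left.2 fun x hx => hr hx
    simp only [hm, this, ha]
  have hlr : l - 1 ≤ r := by
    by_contra! h
    have := hmono h.le
    rw [hml, hmr] at this
    linarith
  have hivt : ∀ c ∈ Icc 0 a, ∃ t, m t = c := by
    intro c hc
    have := intermediate_value_Icc hlr hlip.continuous.continuousOn
    rw [hml, hmr] at this
    obtain ⟨t, -, ht⟩ := this hc
    exact ⟨t, ht⟩
  refine ⟨fun t => ⌊m t / (a - m t)⌋₊, ?_, fun n => ?_⟩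
  · have hmm : Measurable m := hmono.measurable
    exact Nat.measurable_floor.comp (hmm.div (measurable_const.sub hmm))
  -- the values `c < d` of `m` lie strictly between `a * n / (n + 1)` and `a * (n + 1) / (n + 2)`
  have hn1 : (0 : ℝ) < n + 1 := by positivity
  have hn2 : (0 : ℝ) < n + 2 := by positivity
  set c : ℝ := a * n / (n + 1) with hc
  set d : ℝ := a * (n + 1) / (n + 2) with hd
  have hcd : c < d := by
    rw [hc, hd, div_lt_div_iff₀ hn1 hn2]
    nlinarith
  have hc0 : 0 ≤ c := by positivity
  have hda : d < a := by
    rw [hd, div_lt_iff₀ hn2]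
    nlinarith
  obtain ⟨s, hs⟩ := hivt c ⟨hc0, by linarith⟩
  obtain ⟨t, ht⟩ := hivt ((c + d) / 2) ⟨by linarith, by linarith⟩
  have hst : s ≤ t := by
    by_contra! h
    have := hmono h.le
    linarith
  have hpos' : 0 < volume.real (A ∩ Ioc s t) := by
    have := hadd s t hst
    linarith
  refine lt_of_lt_of_le (pos_iff_ne_zero.2 fun h0 => ?_)
    (measure_mono (μ := volume) (?_ : A ∩ Ioc s t ⊆ _))
  · rw [Measure.real, h0] at hpos'
    simp at hpos'
  · rintro x ⟨hxA, hsx, hxt⟩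
    refine ⟨hxA, ?_⟩
    have h1 : c ≤ m x := hs ▸ hmono hsx.le
    have h2 : m x < d := lt_of_le_of_lt (hmono hxt) (by linarith)
    have h3 : 0 < a - m x := by linarith
    change ⌊m x / (a - m x)⌋₊ = n
    rw [Nat.floor_eq_iff (div_nonneg (by linarith) h3.le), le_div_iff₀ h3, div_lt_iff₀ h3]
    rw [hc, div_le_iff₀ hn1] at h1
    rw [hd, lt_div_iff₀ hn2] at h2
    constructor <;> linarith

/-! ### Averaging functionals in the Lipschitz-free space -/

theorem Measurable.integrableOn_of_abs_le {w : ℝ → ℝ} {c : ℝ} (hw : Measurable w)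
    (hc : ∀ s, |w s| ≤ c) {S : Set ℝ} (hS : volume S ≠ ∞) : IntegrableOn w S :=
  Measure.integrableOn_of_bounded (M := c) hS hw.aestronglyMeasurable (ae_of_all _ hc)

theorem Measurable.intervalIntegrable_of_abs_le {w : ℝ → ℝ} {c : ℝ} (hw : Measurable w)
    (hc : ∀ s, |w s| ≤ c) (a b : ℝ) : IntervalIntegrable w volume a b :=
  ⟨hw.integrableOn_of_abs_le hc measure_Ioc_lt_top.ne,
    hw.integrableOn_of_abs_le hc measure_Ioc_lt_top.ne⟩

section Average

variable {M : Type*} [MetricSpace M] {o : M}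

/-- The restriction of `f` to an isometric copy of `K ⊆ ℝ` is the integral of a function bounded by
the Lipschitz norm: extend to `ℝ` and differentiate. -/
theorem Lip0.exists_density (f : Lip0 o) {K : Set ℝ} {σ : ℝ → M}
    (hσ : ∀ s ∈ K, ∀ t ∈ K, dist (σ s) (σ t) = |s - t|) :
    ∃ w : ℝ → ℝ, Measurable w ∧ (∀ s, |w s| ≤ ‖f‖) ∧
      ∀ a ∈ K, ∀ b ∈ K, f (σ b) - f (σ a) = ∫ s in a..b, w s := by
  have hlip : LipschitzOnWith ‖f‖₊ (fun t => f (σ t)) K := by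
    refine LipschitzOnWith.of_dist_le_mul fun s hs t ht => ?_
    rw [Real.dist_eq, Real.dist_eq, ← hσ s hs t ht, dist_comm, coe_nnnorm]
    exact f.abs_sub_le _ _
  obtain ⟨F, hF, hFeq⟩ := hlip.extend_real
  refine ⟨deriv F, measurable_deriv F, fun s => ?_, fun a ha b hb => ?_⟩
  · simpa using norm_deriv_le_of_lipschitz (x₀ := s) hF
  · rw [hF.lipschitzOnWith.absolutelyContinuousOnInterval.integral_deriv_eq_sub,
      ← hFeq hb, ← hFeq ha]

/-- Integration over `K` of the densities of Lipschitz functions is a limit of combinations of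
evaluations: sum the increments of `f` over a finite cover of `K` by disjoint intervals with
endpoints in `K` and small excess measure. -/
theorem exists_mem_span_abs_sub_setIntegral_le {K : Set ℝ} (hK : IsCompact K) (σ : ℝ → M)
    {ε : ℝ} (hε : 0 < ε) :
    ∃ ν ∈ Submodule.span ℝ (range (Lip0.eval o)), ∀ (f : Lip0 o) (w : ℝ → ℝ) (c : ℝ),
      Measurable w → (∀ s, |w s| ≤ c) →
      (∀ a ∈ K, ∀ b ∈ K, f (σ b) - f (σ a) = ∫ s in a..b, w s) →
      |ν f - ∫ s in K, w s| ≤ c * ε := by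
  obtain ⟨S, a, b, hab, hdisj, hcov, hvol⟩ := hK.exists_finset_Icc_cover hε
  refine ⟨∑ U ∈ S, (Lip0.eval o (σ (b U)) - Lip0.eval o (σ (a U))), ?_, ?_⟩
  · exact Submodule.sum_mem _ fun U _ => Submodule.sub_mem _
      (Submodule.subset_span ⟨_, rfl⟩) (Submodule.subset_span ⟨_, rfl⟩)
  intro f w c hw hc hfw
  have hfinU : volume (⋃ U ∈ S, Icc (a U) (b U)) < ∞ :=
    measure_biUnion_lt_top S.finite_toSet fun U _ => measure_Icc_lt_top
  have hsum : (∑ U ∈ S, (Lip0.eval o (σ (b U)) - Lip0.eval o (σ (a U)))) f =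
      ∫ s in ⋃ U ∈ S, Icc (a U) (b U), w s := by
    rw [integral_biUnion_finset S (fun U _ => measurableSet_Icc) hdisj
      (fun U _ => hw.integrableOn_of_abs_le hc measure_Icc_lt_top.ne), sum_apply]
    refine Finset.sum_congr rfl fun U hU => ?_
    obtain ⟨h1, h2, h3⟩ := hab U hU
    rw [integral_Icc_eq_integral_Ioc, ← intervalIntegral.integral_of_le h3, ← hfw _ h1 _ h2]
    rfl
  rw [hsum, ← setIntegral_sdiff hK.measurableSet (hw.integrableOn_of_abs_le hc hfinU.ne) hcov,
    ← Real.norm_eq_abs]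
  have hc0 : 0 ≤ c := (abs_nonneg _).trans (hc 0)
  exact (norm_setIntegral_le_of_norm_le_const
    ((measure_mono sdiff_subset).trans_lt hfinU) fun s _ => hc s).trans
      (mul_le_mul_of_nonneg_left hvol hc0)

/-- The average over `K` of the derivative along an isometric copy of `K` is a functional of norm at
most one in the Lipschitz-free space. -/
theorem LipschitzFree.exists_average {K : Set ℝ} (hK : IsCompact K) (hpos : 0 < volume K)
    {σ : ℝ → M} (hσ : ∀ s ∈ K, ∀ t ∈ K, dist (σ s) (σ t) = |s - t|) :
    ∃ μ : LipschitzFree o, ‖μ‖ ≤ 1 ∧ ∀ (f : Lip0 o) (w : ℝ → ℝ) (c : ℝ),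
      Measurable w → (∀ s, |w s| ≤ c) →
      (∀ a ∈ K, ∀ b ∈ K, f (σ b) - f (σ a) = ∫ s in a..b, w s) →
      μ.incl f = (volume.real K)⁻¹ * ∫ s in K, w s := by
  have hK0 : 0 < volume.real K := ENNReal.toReal_pos hpos.ne' hK.measure_ne_top
  choose ν hνmem hν using fun n : ℕ =>
    exists_mem_span_abs_sub_setIntegral_le (o := o) hK σ (Nat.one_div_pos_of_nat (α := ℝ) (n := n))
  have hlim0 : Tendsto (fun n : ℕ => 1 / ((n : ℝ) + 1)) atTop (𝓝 0) :=
    tendsto_one_div_add_atTop_nhds_zero_nat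
  have hcauchy : CauchySeq ν := by
    refine cauchySeq_of_le_tendsto_0 (fun n : ℕ => 2 * (1 / ((n : ℝ) + 1))) (fun n m k hn hm => ?_)
      (by simpa using hlim0.const_mul 2)
    rw [dist_eq_norm]
    refine ContinuousLinearMap.opNorm_le_bound _ (by positivity) fun f => ?_
    obtain ⟨w, hw, hwf, hfw⟩ := f.exists_density hσ
    have h1 := hν n f w _ hw hwf hfw
    have h2 := hν m f w _ hw hwf hfw
    have h3 : 1 / ((n : ℝ) + 1) ≤ 1 / ((k : ℝ) + 1) := Nat.one_div_le_one_div hn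
    have h4 : 1 / ((m : ℝ) + 1) ≤ 1 / ((k : ℝ) + 1) := Nat.one_div_le_one_div hm
    have h5 := mul_le_mul_of_nonneg_left h3 (norm_nonneg f)
    have h6 := mul_le_mul_of_nonneg_left h4 (norm_nonneg f)
    rw [abs_le] at h1 h2
    rw [sub_apply, Real.norm_eq_abs, abs_le]
    constructor <;> linarith
  obtain ⟨φ, hφ⟩ := cauchySeq_tendsto_of_complete hcauchy
  have hφmem : φ ∈ lipschitzFreeSubmodule o :=
    (Submodule.isClosed_topologicalClosure _).mem_of_tendsto hφ
      (Eventually.of_forall fun n => Submodule.le_topologicalClosure _ (hνmem n))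
  have hφeval : ∀ (f : Lip0 o) (w : ℝ → ℝ) (c : ℝ), Measurable w → (∀ s, |w s| ≤ c) →
      (∀ a ∈ K, ∀ b ∈ K, f (σ b) - f (σ a) = ∫ s in a..b, w s) → φ f = ∫ s in K, w s := by
    intro f w c hw hc hfw
    have h1 : Tendsto (fun n => ν n f) atTop (𝓝 (φ f)) :=
      ((ContinuousLinearMap.apply ℝ ℝ f).continuous.tendsto φ).comp hφ
    refine tendsto_nhds_unique h1 (tendsto_iff_norm_sub_tendsto_zero.2 ?_)
    exact squeeze_zero (fun _ => norm_nonneg _) (fun n => hν n f w c hw hc hfw)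
      (by simpa using hlim0.const_mul c)
  have hφnorm : ‖φ‖ ≤ volume.real K := by
    refine ContinuousLinearMap.opNorm_le_bound _ hK0.le fun f => ?_
    obtain ⟨w, hw, hwf, hfw⟩ := f.exists_density hσ
    rw [hφeval f w _ hw hwf hfw, mul_comm]
    exact norm_setIntegral_le_of_norm_le_const hK.measure_lt_top fun s _ => hwf s
  refine ⟨(⟨(volume.real K)⁻¹ • φ, Submodule.smul_mem _ _ hφmem⟩ : lipschitzFreeSubmodule o),
    ?_, fun f w c hw hc hfw => ?_⟩
  · change ‖(volume.real K)⁻¹ • φ‖ ≤ 1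
    rw [norm_smul, Real.norm_of_nonneg (inv_nonneg.2 hK0.le), inv_mul_le_iff₀ hK0, mul_one]
    exact hφnorm
  · rw [← hφeval f w c hw hc hfw]
    rfl

end Average

/-! ### Functions whose slopes are carried by a thin compact set -/

section FiberWeight

variable {A : Set ℝ} {N : ℝ → ℕ}

/-- The bounded function on the line with value `x n` on the `n`-th fibre of `N` in `A`, and zero
outside `A`. -/
noncomputable def fiberWeight (A : Set ℝ) (N : ℝ → ℕ) (x : lp (fun _ : ℕ => ℝ) ∞) : ℝ → ℝ :=
  A.indicator fun s => x (N s)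

theorem measurable_fiberWeight (hA : MeasurableSet A) (hN : Measurable N)
    (x : lp (fun _ : ℕ => ℝ) ∞) : Measurable (fiberWeight A N x) :=
  ((measurable_from_nat (f := fun n => x n)).comp hN).indicator hA

theorem abs_fiberWeight_le (x : lp (fun _ : ℕ => ℝ) ∞) (s : ℝ) :
    |fiberWeight A N x s| ≤ ‖x‖ := by
  by_cases hs : s ∈ A
  · rw [fiberWeight, indicator_of_mem hs]
    exact lp.norm_apply_le_norm ENNReal.top_ne_zero x _
  · rw [fiberWeight, indicator_of_notMem hs, abs_zero]
    exact norm_nonneg _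

theorem integral_fiberWeight_sub (hA : MeasurableSet A) (hN : Measurable N)
    (x : lp (fun _ : ℕ => ℝ) ∞) (a b c : ℝ) :
    (∫ s in a..c, fiberWeight A N x s) - ∫ s in a..b, fiberWeight A N x s =
      ∫ s in b..c, fiberWeight A N x s :=
  intervalIntegral.integral_interval_sub_left
    ((measurable_fiberWeight hA hN x).intervalIntegrable_of_abs_le (abs_fiberWeight_le x) _ _)
    ((measurable_fiberWeight hA hN x).intervalIntegrable_of_abs_le (abs_fiberWeight_le x) _ _)

end FiberWeight

/-- `σ` embeds `C ⊆ ℝ` isometrically in `M`, and `π` sends each point of `M` to the parameter at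
which it is attached to the line: on the way from `p` to `q` one passes, in order, all points of
the copy of `C` with parameters between `π p` and `π q`. -/
structure IsGatedCopy {M : Type*} [MetricSpace M] (C : Set ℝ) (σ : ℝ → M) (π : M → ℝ) : Prop where
  gate_point : ∀ t ∈ C, π (σ t) = t
  abs_sub_le : ∀ p q, |π q - π p| ≤ dist p q
  dist_eq : ∀ {p q : M} {s t : ℝ}, s ∈ C → t ∈ C → π p ≤ s → s < t → t ≤ π q →
    dist p q = dist p (σ s) + (t - s) + dist (σ t) q

namespace IsGatedCopy

variable {M : Type*} [MetricSpace M] {C : Set ℝ} {σ : ℝ → M} {π : M → ℝ}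

theorem dist_of_lt (h : IsGatedCopy C σ π) {s t : ℝ} (hs : s ∈ C) (ht : t ∈ C) (hst : s < t) :
    dist (σ s) (σ t) = t - s := by
  simpa using h.dist_eq hs ht (h.gate_point s hs).le hst (h.gate_point t ht).ge

theorem dist_eq_abs (h : IsGatedCopy C σ π) (s : ℝ) (hs : s ∈ C) (t : ℝ) (ht : t ∈ C) :
    dist (σ s) (σ t) = |s - t| := by
  rcases lt_trichotomy s t with hst | rfl | hst
  · rw [h.dist_of_lt hs ht hst, abs_of_neg (sub_neg.2 hst), neg_sub]
  · simp
  · rw [dist_comm, h.dist_of_lt ht hs hst, abs_of_pos (sub_pos.2 hst)]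

/-- If the gates of any two points either have equal values under `f` or enclose two points of the
copy of `C` with equal values, then `f` is far from strongly norm-attaining functions, whose slope
is extremal between any two points that lie on the way from `p` to `q`. -/
theorem notMem_closure_SNA (h : IsGatedCopy C σ π) {o : M} {f : Lip0 o} (hf : f ≠ 0)
    (hflat : ∀ p q : M, π p ≤ π q → f p = f q ∨
      ∃ u ∈ C, ∃ v ∈ C, π p ≤ u ∧ u < v ∧ v ≤ π q ∧ f (σ u) = f (σ v)) :
    f ∉ closure (Lip0.SNA o) := by
  intro hcl
  have hf0 : 0 < ‖f‖ := norm_pos_iff.2 hf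
  obtain ⟨g, ⟨p, q, hpq, hg⟩, hfg⟩ := Metric.mem_closure_iff.1 hcl (‖f‖ / 4) (by positivity)
  rw [dist_comm, dist_eq_norm] at hfg
  have hgf : ‖f‖ ≤ ‖g‖ + ‖f‖ / 4 := by
    have := norm_sub_norm_le f g
    rw [norm_sub_rev] at this
    linarith
  have hgn : |g q - g p| = ‖g‖ * dist p q := by
    rw [← hg, Lip0.slope, abs_div, abs_of_pos (dist_pos.2 hpq),
      div_mul_cancel₀ _ (dist_pos.2 hpq).ne']
  -- where `f` has equal values, `g` has slope at most `‖f‖ / 4`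
  have hsmall : ∀ r s : M, f r = f s → |g s - g r| ≤ ‖f‖ / 4 * dist r s := by
    intro r s hrs
    have h1 := (g - f).abs_sub_le r s
    have e : (g - f) s - (g - f) r = g s - g r := by
      change (g s - f s) - (g r - f r) = _
      rw [hrs]
      ring
    rw [e] at h1
    exact h1.trans (mul_le_mul_of_nonneg_right hfg.le dist_nonneg)
  wlog hle : π p ≤ π q generalizing p q
  · refine this q p hpq.symm ?_ ?_ (le_of_not_ge hle)
    · rw [← hg, Lip0.slope, Lip0.slope, abs_div, abs_div, abs_sub_comm, dist_comm]
    · rw [abs_sub_comm, hgn, dist_comm]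
  have hd : 0 < dist p q := dist_pos.2 hpq
  rcases hflat p q hle with heq | ⟨u, hu, v, hv, hpu, huv, hvq, heq⟩
  · have := hsmall p q heq
    rw [hgn] at this
    have := le_of_mul_le_mul_right this hd
    linarith
  · have h1 := hsmall _ _ heq
    have h2 := g.abs_sub_le p (σ u)
    have h3 := g.abs_sub_le (σ v) q
    rw [h.dist_of_lt hu hv huv] at h1
    have h4 : |g q - g p| ≤ |g q - g (σ v)| + |g (σ v) - g (σ u)| + |g (σ u) - g p| := by
      have e : g q - g p = (g q - g (σ v)) + (g (σ v) - g (σ u)) + (g (σ u) - g p) := by ring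
      rw [e]
      exact abs_add_three _ _ _
    rw [hgn, h.dist_eq hu hv hpu huv hvq] at h4
    have h5 : ‖g‖ * (v - u) ≤ ‖f‖ / 4 * (v - u) := by linarith
    have := le_of_mul_le_mul_right h5 (sub_pos.2 huv)
    linarith

variable {A : Set ℝ} {N : ℝ → ℕ}

theorem abs_integral_fiberWeight_le (h : IsGatedCopy C σ π) (x : lp (fun _ : ℕ => ℝ) ∞) (p q : M) :
    |∫ s in π p..π q, fiberWeight A N x s| ≤ ‖x‖ * dist p q :=
  (intervalIntegral.norm_integral_le_of_norm_le_const (f := fiberWeight A N x)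
    fun s _ => abs_fiberWeight_le x s).trans
      (mul_le_mul_of_nonneg_left (h.abs_sub_le p q) (norm_nonneg x))

/-- The linear map sending a bounded sequence `x` to the Lipschitz function that, along the gates,
has derivative `fiberWeight A N x`. -/
noncomputable def lipOfSeq (h : IsGatedCopy C σ π) (hA : MeasurableSet A) (hN : Measurable N)
    (o : M) : lp (fun _ : ℕ => ℝ) ∞ →ₗ[ℝ] Lip0 o where
  toFun x := ⟨fun p => ∫ s in π o..π p, fiberWeight A N x s,
    ⟨‖x‖₊, LipschitzWith.of_dist_le_mul fun p q => by
      rw [dist_comm, Real.dist_eq, integral_fiberWeight_sub hA hN]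
      exact h.abs_integral_fiberWeight_le x p q⟩, intervalIntegral.integral_same⟩
  map_add' x y := by
    apply Lip0.coe_injective
    funext p
    change ∫ s in π o..π p, fiberWeight A N (x + y) s =
      (∫ s in π o..π p, fiberWeight A N x s) + ∫ s in π o..π p, fiberWeight A N y s
    rw [← intervalIntegral.integral_add
      ((measurable_fiberWeight hA hN x).intervalIntegrable_of_abs_le (abs_fiberWeight_le x) _ _)
      ((measurable_fiberWeight hA hN y).intervalIntegrable_of_abs_le (abs_fiberWeight_le y) _ _)]
    congr 1
    funext s
    exact congrFun (indicator_add A (fun s => x (N s)) fun s => y (N s)) s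
  map_smul' c x := by
    apply Lip0.coe_injective
    funext p
    change ∫ s in π o..π p, fiberWeight A N (c • x) s = c * ∫ s in π o..π p, fiberWeight A N x s
    rw [← intervalIntegral.integral_const_mul]
    congr 1
    funext s
    exact congrFun (indicator_const_smul A c fun s => x (N s)) s

theorem lipOfSeq_sub (h : IsGatedCopy C σ π) (hA : MeasurableSet A) (hN : Measurable N) (o : M)
    (x : lp (fun _ : ℕ => ℝ) ∞) (p q : M) :
    h.lipOfSeq hA hN o x q - h.lipOfSeq hA hN o x p = ∫ s in π p..π q, fiberWeight A N x s :=
  integral_fiberWeight_sub hA hN x _ _ _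

theorem norm_lipOfSeq_le (h : IsGatedCopy C σ π) (hA : MeasurableSet A) (hN : Measurable N) (o : M)
    (x : lp (fun _ : ℕ => ℝ) ∞) : ‖h.lipOfSeq hA hN o x‖ ≤ ‖x‖ := by
  rw [Lip0.norm_def]
  refine Real.iSup_le ?_ (norm_nonneg x)
  rintro ⟨⟨p, q⟩, hpq⟩
  rw [Lip0.slope, abs_div, abs_of_pos (dist_pos.2 hpq), div_le_iff₀ (dist_pos.2 hpq), lipOfSeq_sub]
  exact h.abs_integral_fiberWeight_le x p q

/-- The average over a compact part of a fibre recovers the corresponding term of the sequence. -/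
theorem exists_incl_lipOfSeq_eq (h : IsGatedCopy C σ π) (hA : MeasurableSet A) (hN : Measurable N)
    (hAC : A ⊆ C) (hfib : ∀ n, 0 < volume (A ∩ N ⁻¹' {n})) (o : M) (n : ℕ) :
    ∃ μ : LipschitzFree o, ‖μ‖ ≤ 1 ∧ ∀ x, μ.incl (h.lipOfSeq hA hN o x) = x n := by
  obtain ⟨K, hKA, hK, hKpos⟩ :=
    (hA.inter (hN (measurableSet_singleton n))).exists_lt_isCompact (hfib n)
  have hKC : K ⊆ C := fun t ht => hAC (hKA ht).1
  obtain ⟨μ, hμ, hμeval⟩ := LipschitzFree.exists_average (o := o) hK hKpos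
    fun s hs t ht => h.dist_eq_abs s (hKC hs) t (hKC ht)
  refine ⟨μ, hμ, fun x => ?_⟩
  rw [hμeval _ _ _ (measurable_fiberWeight hA hN x) (abs_fiberWeight_le x) fun a ha b hb => by
    rw [lipOfSeq_sub, h.gate_point a (hKC ha), h.gate_point b (hKC hb)]]
  have hconst : ∫ s in K, fiberWeight A N x s = ∫ _ in K, x n :=
    setIntegral_congr_fun hK.measurableSet fun s hs => by
      have hns : N s = n := (hKA hs).2
      rw [fiberWeight, indicator_of_mem (hKA hs).1, hns]
  have hK0 : volume.real K ≠ 0 := (ENNReal.toReal_pos hKpos.ne' hK.measure_ne_top).ne'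
  rw [hconst, setIntegral_const, smul_eq_mul, inv_mul_cancel_left₀ hK0]

/-- `lipOfSeq` as a linear isometry, for fibres of positive measure: the averages over the
fibres bound the Lipschitz norm from below. -/
noncomputable def lipOfSeqₗᵢ (h : IsGatedCopy C σ π) (hA : MeasurableSet A) (hN : Measurable N)
    (hAC : A ⊆ C) (hfib : ∀ n, 0 < volume (A ∩ N ⁻¹' {n})) (o : M) :
    lp (fun _ : ℕ => ℝ) ∞ →ₗᵢ[ℝ] Lip0 o where
  toLinearMap := h.lipOfSeq hA hN o
  norm_map' x := by
    refine le_antisymm (h.norm_lipOfSeq_le hA hN o x) ?_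
    refine lp.norm_le_of_forall_le (norm_nonneg _) fun n => ?_
    obtain ⟨μ, hμ, hμx⟩ := h.exists_incl_lipOfSeq_eq hA hN hAC hfib o n
    rw [← hμx x]
    refine (μ.incl.le_opNorm _).trans ?_
    exact mul_le_of_le_one_left (norm_nonneg _) hμ

theorem lipOfSeqₗᵢ_notMem_closure_SNA (h : IsGatedCopy C σ π) (hA : MeasurableSet A)
    (hN : Measurable N) (hAC : A ⊆ C) (hfib : ∀ n, 0 < volume (A ∩ N ⁻¹' {n})) (o : M)
    (hthin : ∀ p q, volume (A ∩ Icc p q) = 0 ∨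
      ∃ u ∈ C, ∃ v ∈ C, p ≤ u ∧ u < v ∧ v ≤ q ∧ A ∩ Ioo u v = ∅)
    {x : lp (fun _ : ℕ => ℝ) ∞} (hx : x ≠ 0) :
    h.lipOfSeqₗᵢ hA hN hAC hfib o x ∉ closure (Lip0.SNA o) := by
  refine h.notMem_closure_SNA
    (fun h0 => hx ((h.lipOfSeqₗᵢ hA hN hAC hfib o).injective (h0.trans (map_zero _).symm))) ?_
  have hzero : ∀ p q : M, π p ≤ π q → volume (A ∩ Ioo (π p) (π q)) = 0 →
      h.lipOfSeqₗᵢ hA hN hAC hfib o x p = h.lipOfSeqₗᵢ hA hN hAC hfib o x q := by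
    intro p q hpq h0
    refine (sub_eq_zero.1 ((h.lipOfSeq_sub hA hN o x p q).trans ?_)).symm
    rw [intervalIntegral.integral_of_le hpq, integral_Ioc_eq_integral_Ioo]
    change ∫ s in Ioo (π p) (π q), A.indicator (fun s => x (N s)) s = 0
    rw [setIntegral_indicator hA, inter_comm, Measure.restrict_eq_zero.2 h0, integral_zero_measure]
  intro p q hpq
  rcases hthin (π p) (π q) with h0 | ⟨u, hu, v, hv, hpu, huv, hvq, h0⟩
  · exact Or.inl (hzero p q hpq
      (measure_mono_null (inter_subset_inter_right _ Ioo_subset_Icc_self) h0))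
  · refine Or.inr ⟨u, hu, v, hv, hpu, huv, hvq, hzero _ _ ?_ ?_⟩
    · rw [h.gate_point u hu, h.gate_point v hv]
      exact huv.le
    · rw [h.gate_point u hu, h.gate_point v hv, h0, measure_empty]

theorem lipOfSeqₗᵢ_mem_NA (h : IsGatedCopy C σ π) (hA : MeasurableSet A)
    (hN : Measurable N) (hAC : A ⊆ C) (hfib : ∀ n, 0 < volume (A ∩ N ⁻¹' {n})) (o : M)
    {x : lp (fun _ : ℕ => ℝ) ∞} (hx : x ≠ 0) {n : ℕ} (hn : |x n| = ‖x‖) :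
    h.lipOfSeqₗᵢ hA hN hAC hfib o x ∈ Lip0.NA o := by
  set f := h.lipOfSeqₗᵢ hA hN hAC hfib o x with hf
  obtain ⟨μ, hμ, hμx⟩ := h.exists_incl_lipOfSeq_eq hA hN hAC hfib o n
  have hval : |f.toDual μ| = ‖x‖ := by
    rw [← hn, ← hμx x]
    rfl
  have hx0 : 0 < ‖x‖ := norm_pos_iff.2 hx
  have hdual : ‖f.toDual‖ ≤ ‖x‖ := by
    rw [← (h.lipOfSeqₗᵢ hA hN hAC hfib o).norm_map x]
    exact LinearMap.mkContinuous_norm_le _ (norm_nonneg _) _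
  have hle : ‖x‖ ≤ ‖f.toDual‖ * ‖μ‖ := by
    rw [← hval]
    exact f.toDual.le_opNorm μ
  have hμ1 : ‖μ‖ = 1 := by
    refine le_antisymm hμ (le_of_mul_le_mul_left ?_ hx0)
    rw [mul_one]
    exact hle.trans (mul_le_mul_of_nonneg_right hdual (norm_nonneg μ))
  refine ⟨μ, hμ1, ?_⟩
  rw [hμ1, mul_one] at hle
  rw [hval]
  exact le_antisymm hle hdual

end IsGatedCopy

/-! ### Closed subsets of real trees of positive length -/

/-- A closed subset of positive length contains a gated copy of a compact set of positive measure: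
its trace on a segment. -/
theorem IsRealTree.exists_isGatedCopy {T : Type*} [MetricSpace T] (hT : IsRealTree T) {M : Set T}
    (hM : IsClosed M) (o : M) (hpos : 0 < hT.lengthMeasure M) :
    ∃ (C : Set ℝ) (σ : ℝ → M) (π : M → ℝ), IsCompact C ∧ 0 < volume C ∧ IsGatedCopy C σ π := by
  classical
  obtain ⟨F, hF⟩ := lt_iSup_iff.1 hpos
  obtain ⟨-, hF⟩ := lt_iSup_iff.1 hF
  obtain ⟨⟨x, y⟩, -, he⟩ := Finset.exists_ne_zero_of_sum_ne_zero hF.ne'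
  set C : Set ℝ := Subtype.val '' (hT.geodesic x y ⁻¹' M) with hC
  have hCmem : ∀ t ∈ C, t ∈ Icc 0 (dist x y) ∧ hT.path x y t ∈ M := by
    rintro _ ⟨t, ht, rfl⟩
    refine ⟨t.2, ?_⟩
    rw [hT.path_of_mem t.2]
    exact ht
  let σ : ℝ → M := fun t => if h : hT.path x y t ∈ M then ⟨hT.path x y t, h⟩ else o
  have hσ : ∀ t ∈ C, (σ t : T) = hT.path x y t := fun t ht => by
    simp only [σ, dif_pos (hCmem t ht).2]
  refine ⟨C, σ, fun p => hT.gate x y p, ?_, pos_iff_ne_zero.2 he, ?_, ?_, ?_⟩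
  · exact (hM.preimage (hT.isGeodesic_geodesic x y).1.continuous).isCompact.image
      continuous_subtype_val
  · intro t ht
    simp only [hσ t ht]
    exact hT.gate_path (hCmem t ht).1
  · exact fun p q => hT.abs_gate_sub_le x y p q
  · intro p q s t hs ht hps hst htq
    rw [Subtype.dist_eq, Subtype.dist_eq, Subtype.dist_eq, hσ s hs, hσ t ht]
    exact hT.dist_eq_of_gate_le hps hst htq

/-- The isometric inclusion of `c₀` in `ℓ∞`. -/
noncomputable def c0ToLinfty : C₀(ℕ, ℝ) →ₗᵢ[ℝ] lp (fun _ : ℕ => ℝ) ∞ :=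
  (lpBCFₗᵢ ℝ ℝ).symm.toLinearIsometry.comp
    ({ toFun := ZeroAtInftyContinuousMap.toBCF
       map_add' := fun _ _ => rfl
       map_smul' := fun _ _ => rfl
       norm_map' := fun _ => rfl } : C₀(ℕ, ℝ) →ₗᵢ[ℝ] BoundedContinuousFunction ℕ ℝ)

/-- The supremum norm of a null sequence is attained. -/
theorem exists_abs_c0ToLinfty_eq_norm (x : C₀(ℕ, ℝ)) :
    ∃ n, |c0ToLinfty x n| = ‖c0ToLinfty x‖ := by
  have hcoe : ∀ n, c0ToLinfty x n = x n := fun _ => rfl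
  obtain ⟨m, hm⟩ : ∃ m, ∀ n, |x n| ≤ |x m| := by
    by_cases h0 : ∀ n, x n = 0
    · exact ⟨0, fun n => by simp [h0]⟩
    · obtain ⟨k, hk⟩ := not_forall.1 h0
      have hlim : Tendsto (fun n => |x n|) (cocompact ℕ) (𝓝 0) := by
        simpa using x.zero_at_infty'.abs
      exact (x.continuous.abs).exists_forall_ge'
        k ((hlim.eventually (gt_mem_nhds (abs_pos.2 hk))).mono fun _ => le_of_lt)
  refine ⟨m, le_antisymm
    (lp.norm_apply_le_norm ENNReal.top_ne_zero (c0ToLinfty x) m) ?_⟩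
  exact lp.norm_le_of_forall_le (abs_nonneg _) fun n => hm n

theorem mainTheorem5 {T : Type*} [MetricSpace T] (hT : IsRealTree T)
    (M : Set T) (hM : IsClosed M) (o : M) (hpos : 0 < hT.lengthMeasure M) :
    IsometricallyContains (lp (fun _ : ℕ => ℝ) ∞)
        ((Set.univ \ closure (Lip0.SNA o)) ∪ {0} : Set (Lip0 o)) ∧
      IsometricallyContains C₀(ℕ, ℝ)
        ((Lip0.NA o \ closure (Lip0.SNA o)) ∪ {0} : Set (Lip0 o)) := by
  obtain ⟨C, σ, π, hC, hCpos, h⟩ := hT.exists_isGatedCopy hM o hpos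
  obtain ⟨A, hAC, hA, hApos, hthin⟩ := hC.exists_thin_subset hCpos
  obtain ⟨N, hN, hfib⟩ := hA.exists_measurable_nat_fibers hApos
  let J := h.lipOfSeqₗᵢ hA.measurableSet hN hAC hfib o
  refine ⟨⟨J, fun x => ?_⟩, ⟨J.comp c0ToLinfty, fun x => ?_⟩⟩
  · by_cases hx : x = 0
    · right
      rw [hx]
      exact map_zero J
    · exact Or.inl ⟨mem_univ _,
        h.lipOfSeqₗᵢ_notMem_closure_SNA hA.measurableSet hN hAC hfib o hthin hx⟩
  · by_cases hx : c0ToLinfty x = 0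
    · right
      exact (congrArg J hx).trans (map_zero J)
    · obtain ⟨n, hn⟩ := exists_abs_c0ToLinfty_eq_norm x
      exact Or.inl ⟨h.lipOfSeqₗᵢ_mem_NA hA.measurableSet hN hAC hfib o hx hn,
        h.lipOfSeqₗᵢ_notMem_closure_SNA hA.measurableSet hN hAC hfib o hthin hx⟩
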